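/- A statistical query on $\{0,1\}^d$ is a predicate $q:\{0,1\}^d\to\{0,1\}$; for a finite $x\subseteq\{0,1\}^d$ write $q(x)=\frac1{|x|}\sum_{z\in x}q(z)$. An (unbounded) oracle $\mathcal O$ is an arbitrary randomized stateful procedure that holds a sample $x$ and replies to each query with a real number in $[0,1]$. In the game $\mathsf{NonPrivacy}_{n,d,k}[\mathcal O,\mathcal A]$ a randomized stateful adversary $\mathcal A$ chooses a set $y=\{y_1,\dots,y_{2n}\}\subseteq\{0,1\}^d$ of $2n$ distinct points; a uniformly random $x\subseteq y$ with $|x|=n$ is drawn and given to $\mathcal O$ only; then for $j=1,\dots,k$ the adversary chooses a query $q_j$ depending on its randomness and on the previous queries and answers, and $\mathcal O$ returns an answer $a_j$; finally $\mathcal A$ outputs a set $x'\subseteq y$. The randomness of $\mathcal A$, the choice of the subset and the randomness of $\mathcal O$ are independent. $\mathcal O$ is $(\alpha,\beta)$-sample-accurate for $k$ queries given $n$ samples in $\{0,1\}^d$ if for every adversary $\mathcal A$, in the game $\mathsf{NonPrivacy}_{n,d,k}[\mathcal O,\mathcal A]$, $\Pr[\forall j\le k:\ |a_j-q_j(x)|\le\alpha]\ge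 1-\beta$. For functions $k,d:\mathbb N\to\mathbb N$, giving $\alpha$-accurate answers to $k(n)$ adaptively chosen queries on $n$ samples of dimension $d(n)$ is called blatantly non-private for unbounded oracles if there are adversaries $(\mathcal A_n)_{n\in\mathbb N}$ such that for every family of oracles $(\mathcal O_n)_{n\in\mathbb N}$ for which there is a sequence $\beta_n\to0$ such that, for every $n$, $\mathcal O_n$ is $(\alpha,\beta_n)$-sample-accurate for $k(n)$ queries given $n$ samples in $\{0,1\}^{d(n)}$, $$\lim_{n\to\infty}\Pr_{\mathsf{NonPrivacy}_{n,d(n),k(n)}[\mathcal O_n,\mathcal A_n]}\bigl[\,|x\,\triangle\,x'|>n/100\,\bigr]=0 .$$ **Theorem.** There are functions $k_0,d_0:\mathbb N\to\mathbb N$ with $k_0(n)=n^{3+o(1)}$ and $d_0(n)=n^{3+o(1)}$ such that for all functions $k,d:\mathbb N\to\mathbb N$ with $k(n)\ge k_0(n)$ and $d(n)\ge d_0(n)$ for every $n$, giving $\frac1{300}$-accurate answers to $k(n)$ adaptively chosen queries on $n$ samples of dimension $d(n)$ is blatantly non-private for unbounded oracles. In particular this holds for $k=k_0=n^{3+o(1)}$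 and $d=d_0=n^{3+o(1)}$. -/

import Mathlib

open MeasureTheory Filter Topology

universe u

namespace NonPrivacy

/-- Data points are elements of `{0,1}^d`. -/
abbrev Point (d : ℕ) : Type := Fin d → Bool

/-- A statistical query on `{0,1}^d` is a predicate `q : {0,1}^d → {0,1}`. -/
abbrev Query (d : ℕ) : Type := Point d → Bool

/-- `q(x)`: the average of the query `q` over the sample `x`. -/
noncomputable def Query.mean {d : ℕ} (q : Query d) (x : Finset (Point d)) : ℝ :=
  (∑ z ∈ x, if q z then (1 : ℝ) else 0) / x.card

/-- A computationally unbounded, randomized, stateful oracle for data in `{0,1}^d`.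
It tosses all its coins in advance (`law` is their distribution, on an arbitrary probability
space); `answer j ω x qs` is its reply to the last of the queries `qs 0, …, qs j` asked so far
when it holds the sample `x`. Its internal state, and its earlier replies, are functions of the
coins, the sample and the earlier queries, so they need not be passed separately. -/
structure Oracle (d : ℕ) where
  Coins : Type u
  [measurableSpace : MeasurableSpace Coins]
  law : Measure Coins
  [isProbabilityMeasure : IsProbabilityMeasure law]
  answer : (j : ℕ) → Coins → Finset (Point d) → (Fin (j + 1) → Query d) → ℝ
  answer_mem : ∀ j ω x qs, answer j ω x qs ∈ Set.Icc (0 : ℝ) 1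
  measurable_answer : ∀ j x qs, Measurable fun ω => answer j ω x qs

attribute [instance] Oracle.measurableSpace Oracle.isProbabilityMeasure

/-- A randomized, stateful adversary in the non-privacy game with `k` queries. It chooses
`2n` distinct points `y_i` of `{0,1}^d`; `query j ω as` is its query after it has received the
answers `as 0, …, as (j - 1)` (its own earlier queries are functions of its coins and of these
answers); after `k` answers it outputs a subset of `{y_1, …, y_{2n}}`, given as a set of indices.
Measurability of the maps into finite sets is expressed through their fibres. -/
structure Adversary (n d k : ℕ) where
  Coins : Type
  [measurableSpace : MeasurableSpace Coins]
  law : Measure Coins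
  [isProbabilityMeasure : IsProbabilityMeasure law]
  points : Coins → (Fin (2 * n) ↪ Point d)
  query : (j : ℕ) → Coins → (Fin j → ℝ) → Query d
  guess : Coins → (Fin k → ℝ) → Finset (Fin (2 * n))
  measurable_points : ∀ y, MeasurableSet {ω | points ω = y}
  measurable_query : ∀ j q, MeasurableSet {p : Coins × (Fin j → ℝ) | query j p.1 p.2 = q}
  measurable_guess : ∀ s, MeasurableSet {p : Coins × (Fin k → ℝ) | guess p.1 p.2 = s}

attribute [instance] Adversary.measurableSpace Adversary.isProbabilityMeasure

/-- The `n`-element subsets of the index set of `y_1, …, y_{2n}`. -/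
def Subsample (n : ℕ) : Type := {s : Finset (Fin (2 * n)) // s.card = n}

instance (n : ℕ) : MeasurableSpace (Subsample n) := ⊤

variable {n d k : ℕ}

/-- The first `j` rounds of the interaction of the adversary `A` (with coins `a`) and the oracle
`O` (with coins `o`) holding the sample `x`: the queries and the answers. -/
def play (A : Adversary n d k) (O : Oracle.{u} d) (a : A.Coins) (o : O.Coins)
    (x : Finset (Point d)) : (j : ℕ) → (Fin j → Query d) × (Fin j → ℝ)
  | 0 => (Fin.elim0, Fin.elim0)
  | j + 1 =>
    let past := play A O a o x j
    let qs : Fin (j + 1) → Query d := Fin.snoc past.1 (A.query j a past.2)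
    (qs, Fin.snoc past.2 (O.answer j o x qs))

/-- The randomness of the game: the coins of the adversary, the choice of the subsample, and the
coins of the oracle. -/
abbrev Run (A : Adversary n d k) (O : Oracle.{u} d) : Type u :=
  A.Coins × Subsample n × O.Coins

/-- The three sources of randomness are independent, and the subsample is uniform among the
subsets of size `n`. -/
noncomputable def gameLaw (A : Adversary n d k) (O : Oracle.{u} d) : Measure (Run A O) :=
  A.law.prod ((ProbabilityTheory.uniformOn Set.univ).prod O.law)

namespace Run

variable {A : Adversary n d k} {O : Oracle.{u} d}

/-- The sample `x ⊆ y` of size `n` given to the oracle. -/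
def sample (w : Run A O) : Finset (Point d) :=
  w.2.1.val.map (A.points w.1)

/-- The `k` queries of the game. -/
def queries (w : Run A O) : Fin k → Query d :=
  (play A O w.1 w.2.2 w.sample k).1

/-- The `k` answers of the oracle. -/
def answers (w : Run A O) : Fin k → ℝ :=
  (play A O w.1 w.2.2 w.sample k).2

/-- The set `x' ⊆ y` output by the adversary. -/
def output (w : Run A O) : Finset (Point d) :=
  (A.guess w.1 w.answers).map (A.points w.1)

end Run

/-- `O` is `(α, β)`-sample-accurate for `k` adaptively chosen queries given `n` samples. -/
def Oracle.SampleAccurate (O : Oracle.{u} d) (n k : ℕ) (α β : ℝ) : Prop :=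
  ∀ A : Adversary n d k,
    1 - β ≤ (gameLaw A O).real
      {w | ∀ j, |w.answers j - (w.queries j).mean w.sample| ≤ α}

/-- Giving `α`-accurate answers to `k(n)` adaptively chosen queries on `n` samples of dimension
`d(n)` is blatantly non-private for unbounded oracles. An adversary and an oracle are given by
their behaviour for each `n`. -/
def BlatantlyNonPrivate (α : ℝ) (k d : ℕ → ℕ) : Prop :=
  ∃ A : (n : ℕ) → Adversary n (d n) (k n),
    ∀ O : (n : ℕ) → Oracle.{u} (d n),
      (∃ β : ℕ → ℝ, Tendsto β atTop (𝓝 0) ∧ ∀ n, (O n).SampleAccurate n (k n) α (β n)) →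
      Tendsto (fun n => (gameLaw (A n) (O n)).real
        {w | (n : ℝ) / 100 < (symmDiff w.sample w.output).card}) atTop (𝓝 0)

/-- `f(n) = n^{c + o(1)}`. -/
def IsPowAddLittleO (f : ℕ → ℕ) (c : ℝ) : Prop :=
  ∃ ε : ℕ → ℝ, Tendsto ε atTop (𝓝 0) ∧ ∀ᶠ n : ℕ in atTop, (f n : ℝ) = (n : ℝ) ^ (c + ε n)

end NonPrivacy

/-! The attack is an interactive fingerprinting code run behind one-time pads. Each of the `2n` data
points carries the index of a user and a private key with one bit per round. In a round the
adversary draws a uniform position `p` and a uniform bit `b`, gives the bit `1` to the users before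
`p + b` and `0` to the rest, and publishes these bits xored with the round's key bits. A data point
unmasks only its own bit, so the oracle learns nothing about the bits of users outside the sample.
The signed answer is added to the score of user `p`; a user whose score exceeds `σ` is accused, the
score is frozen, and later queries vanish on that user.

Soundness: the choice of `b` changes only the bit of user `p`. If `p` is outside the sample, the
answer is the same for both values of `b`, so the score is a martingale with increments in `[-1,
1]`, nonzero in at most one round out of `2n` on average. An exponential moment bound keeps it below
`σ` (`expect_exp_score_le`, `expect_exists_accused_le`).

Completeness: let `F t` be the answer at threshold `t`. The expected gain of the total score of the
sample is a telescoping sum, `(F (2n) - F 0) / (4n)` (`expect_sum_score`). Accuracy forces `F 0` to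
be near `0` and `F (2n)` near the unaccused fraction of the sample, so the total grows by more than
`1 / (1200 n)` per round while over `n / 100` sampled users are unaccused. Scores never exceed `σ +
1`, so this cannot last (`expect_card_sdiff_accused_le`).

With `L` of order `log n`, the choice `σ = n L^3` and `m = n^3 L^4` rounds makes both errors vanish.
An oracle that is accurate only with high probability is replaced by one that is always accurate and
agrees with it on accurate runs (`play_corrected`). -/

namespace NonPrivacy

open scoped BigOperators

/-! ### Supermartingales on finite product spaces -/

/-- Averaging over one coordinate first does not change the average over all coordinates. -/
theorem expect_eq_expect_expect_update {m : ℕ} {R : Type*} [Fintype R] [Nonempty R]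
    (j : Fin m) (G : (Fin m → R) → ℝ) :
    𝔼 r, G r = 𝔼 r, 𝔼 w, G (Function.update r j w) := by
  classical
  -- Exchanging the fresh value with the old `j`-th coordinate is an involution that preserves the
  -- uniform measure.
  let e : (Fin m → R) × R ≃ (Fin m → R) × R :=
    { toFun := fun p => (Function.update p.1 j p.2, p.1 j)
      invFun := fun p => (Function.update p.1 j p.2, p.1 j)
      left_inv := fun p => by simp
      right_inv := fun p => by simp }
  have h : 𝔼 p : (Fin m → R) × R, G (Function.update p.1 j p.2) =
      𝔼 p : (Fin m → R) × R, G p.1 :=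
    Fintype.expect_equiv e _ _ fun p => rfl
  rw [← Finset.univ_product_univ, Finset.expect_product, Finset.expect_product] at h
  rw [h]
  simp

/-- A process whose average over round `j` grows by a factor of at most `K`. -/
theorem expect_le_pow_mul {m : ℕ} {R : Type*} [Fintype R] [Nonempty R]
    (X : ℕ → (Fin m → R) → ℝ) {K : ℝ} (hK : 0 ≤ K)
    (hX : ∀ (j : Fin m) r, 𝔼 w, X (j + 1) (Function.update r j w) ≤ K * X j r) :
    ∀ j ≤ m, 𝔼 r, X j r ≤ K ^ j * 𝔼 r, X 0 r := by
  intro j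
  induction j with
  | zero => intro _; simp
  | succ j ih =>
    intro hj
    rw [expect_eq_expect_expect_update ⟨j, hj⟩]
    calc _ ≤ 𝔼 r, K * X j r := Finset.expect_le_expect fun r _ => hX ⟨j, hj⟩ r
      _ = K * 𝔼 r, X j r := by rw [Finset.mul_expect]
      _ ≤ K * (K ^ j * 𝔼 r, X 0 r) := mul_le_mul_of_nonneg_left (ih (by omega)) hK
      _ = _ := by ring

/-! ### Rounds, scores and accusations -/

/-- One round of the attack: a position in the list of users, and the bit of the user there. -/
abbrev Round (N : ℕ) : Type := Fin N × Bool

/-- The users before position `t` receive the bit `1`, the others `0`. -/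
def thresholdBits {N : ℕ} (t : ℕ) (i : Fin N) : Bool := decide (i.val < t)

/-- The number of users receiving the bit `1` in a round. -/
def Round.threshold {N : ℕ} (v : Round N) : ℕ := v.1 + v.2.toNat

/-- The two thresholds at a position `p` are `p` and `p + 1`, which separate only user `p`. Both
soundness and the telescoping sum rest on this. -/
theorem thresholdBits_of_ne {N : ℕ} (v w : Round N) (hvw : v.1 = w.1) {i : Fin N} (hi : i ≠ v.1) :
    thresholdBits v.threshold i = thresholdBits w.threshold i := by
  have : i.val ≠ v.1.val := fun h => hi (Fin.ext h)
  obtain ⟨v, b⟩ := v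
  obtain ⟨w, c⟩ := w
  subst hvw
  simp only [thresholdBits, Round.threshold] at *
  cases b <;> cases c <;> simp <;> omega

/-- The score of each user after `j` rounds with answers `a`: the answer in a round is
credited, with the sign given by the bit, to the user at the chosen position, as long as the score
of this user does not exceed `σ`. -/
noncomputable def score {N m : ℕ} (σ : ℝ) (r : Fin m → Round N) (a : ℕ → ℝ) : ℕ → Fin N → ℝ
  | 0, _ => 0
  | j + 1, i => score σ r a j i +
      if h : j < m then
        if (r ⟨j, h⟩).1 = i ∧ score σ r a j i ≤ σ then
          if (r ⟨j, h⟩).2 then a j else -a j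
        else 0
      else 0

/-- The users whose score exceeds `σ` after `j` rounds. -/
noncomputable def accused {N m : ℕ} (σ : ℝ) (r : Fin m → Round N) (a : ℕ → ℝ) (j : ℕ) :
    Finset (Fin N) :=
  Finset.univ.filter fun i => σ < score σ r a j i

theorem score_congr {N m : ℕ} (σ : ℝ) {r r' : Fin m → Round N} {a a' : ℕ → ℝ} {j : ℕ}
    (hr : ∀ l : Fin m, l.val < j → r l = r' l) (ha : ∀ l < j, a l = a' l) :
    score σ r a j = score σ r' a' j := by
  induction j with
  | zero => rfl
  | succ j ih =>
    funext i
    have ih := ih (fun l hl => hr l (by omega)) (fun l hl => ha l (by omega))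
    simp only [score, ih, ha j (by omega)]
    by_cases h : j < m
    · simp only [h, hr ⟨j, h⟩ (Nat.lt_succ_self j)]
    · simp [h]

theorem accused_congr {N m : ℕ} (σ : ℝ) {r r' : Fin m → Round N} {a a' : ℕ → ℝ} {j : ℕ}
    (hr : ∀ l : Fin m, l.val < j → r l = r' l) (ha : ∀ l < j, a l = a' l) :
    accused σ r a j = accused σ r' a' j := by
  simp only [accused, score_congr σ hr ha]

theorem measurable_score {N m : ℕ} (σ : ℝ) (r : Fin m → Round N) (j : ℕ) (i : Fin N) :
    Measurable fun a : ℕ → ℝ => score σ r a j i := by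
  induction j with
  | zero => exact measurable_const
  | succ j ih =>
    simp only [score]
    refine ih.add ?_
    by_cases h : j < m
    · simp only [h, dif_pos]
      refine Measurable.ite ?_ ?_ measurable_const
      · exact (MeasurableSet.const _).inter (measurableSet_le ih measurable_const)
      · by_cases hb : (r ⟨j, h⟩).2
        · simpa only [hb, if_true] using measurable_pi_apply j
        · simp only [hb, Bool.false_eq_true, if_false]
          exact (measurable_pi_apply j).neg
    · simp only [h, dif_neg, not_false_eq_true, measurable_const]

/-- A finite sequence of answers, continued by `0`. -/
def extendZero {j : ℕ} (a : Fin j → ℝ) (l : ℕ) : ℝ := if h : l < j then a ⟨l, h⟩ else 0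

theorem measurable_extendZero {j : ℕ} : Measurable (extendZero : (Fin j → ℝ) → ℕ → ℝ) := by
  refine measurable_pi_lambda _ fun l => ?_
  unfold extendZero
  split_ifs with h
  · exact measurable_pi_apply _
  · exact measurable_const

/-! ### Data points with keys, masked queries and the attack -/

/-- The `l`-th bit of a data point, `0` beyond the dimension. -/
def coord {d : ℕ} (z : Point d) (l : ℕ) : Bool := if h : l < d then z ⟨l, h⟩ else false

/-- The query with bits `e` for the users outside `T`, masked by the key bit `j` of the user. -/
def maskedQuery (d : ℕ) {N : ℕ} (j : ℕ) (T : Finset (Fin N)) (e : Fin N → Bool) : Query d :=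
  fun z => decide (∃ i, i ∉ T ∧ coord z i = true ∧ xor (e i) (coord z (N + j)) = true)

/-- The data points: the identity of the user followed by the key of the user. -/
def encode {d N m : ℕ} (hd : N + m ≤ d) (U : Fin N → Fin m → Bool) : Fin N ↪ Point d where
  toFun i z := if z.val < N then decide (z.val = i)
    else if h : z.val - N < m then U i ⟨z - N, h⟩ else false
  inj' i i' h := by
    -- The identity block is one-hot, so coordinate `i` alone separates the points, whatever the
    -- keys are.
    have h1 := congrFun h ⟨i, by omega⟩
    simpa [Fin.ext_iff] using h1

theorem encode_apply {d N m : ℕ} (hd : N + m ≤ d) (U : Fin N → Fin m → Bool) (i : Fin N)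
    (z : Fin d) : encode hd U i z = if z.val < N then decide (z.val = i)
      else if h : z.val - N < m then U i ⟨z - N, h⟩ else false := rfl

theorem coord_encode_id {d N m : ℕ} (hd : N + m ≤ d) (U : Fin N → Fin m → Bool) (i i' : Fin N) :
    coord (encode hd U i) i' = decide (i' = i) := by
  have : i'.val < d := by omega
  simp [coord, encode_apply, this, Fin.ext_iff]

theorem coord_encode_key {d N m : ℕ} (hd : N + m ≤ d) (U : Fin N → Fin m → Bool) (i : Fin N)
    (j : Fin m) : coord (encode hd U i) (N + j) = U i j := by
  have : N + j.val < d := by omega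
  simp [coord, encode_apply, this]

/-- The one-hot identity leaves a single candidate for the existential quantifier, so each point is
tested against its own masked bit. -/
theorem maskedQuery_encode {d N m : ℕ} (hd : N + m ≤ d) (U : Fin N → Fin m → Bool) (i : Fin N)
    (j : Fin m) (T : Finset (Fin N)) (e : Fin N → Bool) :
    maskedQuery d j T e (encode hd U i) = decide (i ∉ T ∧ xor (e i) (U i j) = true) := by
  simp only [maskedQuery, coord_encode_id, coord_encode_key]
  simp

theorem maskedQuery_congr {d N : ℕ} (j : ℕ) {T : Finset (Fin N)} {e e' : Fin N → Bool}
    (h : ∀ i ∉ T, e i = e' i) : maskedQuery d j T e = maskedQuery d j T e' := by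
  funext z
  simp only [maskedQuery]
  congr 1
  refine propext (exists_congr fun i => and_congr_right fun hi => ?_)
  rw [h i hi]

/-- The query of round `j` of the attack. -/
noncomputable def attackQuery (d : ℕ) {N m : ℕ} (σ : ℝ) (j : ℕ)
    (c : (Fin m → Round N) × (Fin N → Fin m → Bool)) (a : Fin j → ℝ) : Query d :=
  if h : j < m then
    maskedQuery d j (accused σ c.1 (extendZero a) j)
      fun i => xor (thresholdBits (c.1 ⟨j, h⟩).threshold i) (c.2 i ⟨j, h⟩)
  -- Rounds beyond `m` are padding: the attack ignores their answers.
  else fun _ => false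

theorem measurable_attackQuery (d : ℕ) {N m : ℕ} (σ : ℝ) (j : ℕ)
    (c : (Fin m → Round N) × (Fin N → Fin m → Bool)) : Measurable (attackQuery d σ j c) := by
  unfold attackQuery
  split_ifs with h
  · refine measurable_pi_lambda _ fun z => ?_
    refine measurable_to_bool ?_
    have : ((fun a : Fin j → ℝ => maskedQuery d j (accused σ c.1 (extendZero a) j)
        (fun i => xor (thresholdBits (c.1 ⟨j, h⟩).threshold i) (c.2 i ⟨j, h⟩)) z) ⁻¹' {true}) =
        ⋃ i, {a | score σ c.1 (extendZero a) j i ≤ σ} ∩ {_a | coord z i = true ∧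
          xor (xor (thresholdBits (c.1 ⟨j, h⟩).threshold i) (c.2 i ⟨j, h⟩))
            (coord z (N + j)) = true} := by
      ext a
      simp [maskedQuery, accused]
    rw [this]
    refine MeasurableSet.iUnion fun i => MeasurableSet.inter ?_ (MeasurableSet.const _)
    exact measurableSet_le ((measurable_score σ c.1 j i).comp measurable_extendZero)
      measurable_const
  · exact measurable_const

instance uniformOn_univ_isProbabilityMeasure (α : Type*) [MeasurableSpace α] [Finite α]
    [MeasurableSingletonClass α] [Nonempty α] :
    IsProbabilityMeasure (ProbabilityTheory.uniformOn (Set.univ : Set α)) :=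
  ProbabilityTheory.isProbabilityMeasure_uniformOn Set.finite_univ Set.univ_nonempty

/-- The attack with `m` effective queries and threshold `σ` for the accusation of a user. -/
noncomputable def attack (n : ℕ) {d k m : ℕ} (hd : 2 * n + m ≤ d) (σ : ℝ)
    (hm : Nonempty (Fin m → Round (2 * n))) : Adversary n d k where
  Coins := (Fin m → Round (2 * n)) × (Fin (2 * n) → Fin m → Bool)
  law := ProbabilityTheory.uniformOn Set.univ
  points c := encode hd c.2
  query j c a := attackQuery d σ j c a
  guess c a := accused σ c.1 (extendZero a) m
  measurable_points y := MeasurableSet.of_discrete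
  measurable_query j q := by
    have : Measurable fun p : ((Fin m → Round (2 * n)) × (Fin (2 * n) → Fin m → Bool)) ×
        (Fin j → ℝ) => attackQuery d σ j p.1 p.2 :=
      measurable_from_prod_countable_right fun c => measurable_attackQuery d σ j c
    exact this (measurableSet_singleton q)
  measurable_guess s := by
    have h1 : ∀ i, Measurable fun p : ((Fin m → Round (2 * n)) ×
        (Fin (2 * n) → Fin m → Bool)) × (Fin k → ℝ) => score σ p.1.1 (extendZero p.2) m i :=
      fun i => measurable_from_prod_countable_right fun c =>
        (measurable_score σ c.1 m i).comp measurable_extendZero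
    simp only [Finset.ext_iff, accused, Finset.mem_filter, Finset.mem_univ, true_and,
      Set.ofPred_forall]
    refine MeasurableSet.iInter fun i => ?_
    by_cases hi : i ∈ s
    · simpa [hi] using measurableSet_lt measurable_const (h1 i)
    · simpa [hi] using measurableSet_le (h1 i) measurable_const

/-! ### The interaction as a function of the rounds -/

section Transcript

variable {n d k : ℕ} (A : Adversary n d k) (O : Oracle.{u} d) (a : A.Coins) (o : O.Coins)
  (x : Finset (Point d))

/-- The answer in round `l` of the interaction. -/
def reply (l : ℕ) : ℝ := (play A O a o x (l + 1)).2 (Fin.last l)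

theorem play_snd_apply {j : ℕ} (l : Fin j) : (play A O a o x j).2 l = reply A O a o x l := by
  induction j with
  | zero => exact l.elim0
  | succ j ih =>
    induction l using Fin.lastCases with
    | last => rfl
    | cast l => simpa [play] using ih l

theorem extendZero_play {j l : ℕ} (h : l < j) :
    extendZero (play A O a o x j).2 l = reply A O a o x l := by
  simp only [extendZero, h, dif_pos, play_snd_apply]

theorem reply_eq (j : ℕ) : reply A O a o x j = O.answer j o x (play A O a o x (j + 1)).1 := by
  simp [reply, play]

end Transcript

/-- The keys of the users outside `s`, masked by their bits. -/
def twist {N m : ℕ} (s : Finset (Fin N)) (r : Fin m → Round N) (V : Fin N → Fin m → Bool) :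
    Fin N → Fin m → Bool :=
  fun i j => if i ∈ s then V i j else xor (thresholdBits (r j).threshold i) (V i j)

/-- The mask depends only on the rounds and xor cancels itself. Hence, for fixed rounds, uniform
keys outside `s` may be traded for uniform published bits. -/
theorem twist_twist {N m : ℕ} (s : Finset (Fin N)) (r : Fin m → Round N)
    (V : Fin N → Fin m → Bool) : twist s r (twist s r V) = V := by
  funext i j
  simp only [twist]
  split_ifs <;> simp

theorem map_encode_twist {d N m : ℕ} (hd : N + m ≤ d) (s : Finset (Fin N)) (r : Fin m → Round N)
    (V : Fin N → Fin m → Bool) : s.map (encode hd (twist s r V)) = s.map (encode hd V) := by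
  rw [Finset.map_eq_image, Finset.map_eq_image]
  refine Finset.image_congr fun i hi => ?_
  funext z
  have hi' : i ∈ s := hi
  simp [encode_apply, twist, hi']

/-- The bits of a round after masking, when the bits are given by a threshold. -/
def maskedBits {N m : ℕ} (s : Finset (Fin N)) (V : Fin N → Fin m → Bool) (j : Fin m) (t : ℕ)
    (i : Fin N) : Bool :=
  if i ∈ s then xor (thresholdBits t i) (V i j) else V i j

section Analysis

variable {n d k m : ℕ} (hd : 2 * n + m ≤ d) (σ : ℝ) (hm : Nonempty (Fin m → Round (2 * n)))
  (O : Oracle.{u} d) (o : O.Coins) (s : Finset (Fin (2 * n))) (V : Fin (2 * n) → Fin m → Bool)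

/-- The interaction with the attack, when the oracle holds the sample of the users in `s`, as a
function of the rounds. -/
noncomputable def transcript (r : Fin m → Round (2 * n)) (j : ℕ) :
    (Fin j → Query d) × (Fin j → ℝ) :=
  play (attack n (k := k) hd σ hm) O (r, twist s r V) o (s.map (encode hd V)) j

/-- The answers of the oracle as a function of the rounds. -/
noncomputable def transcriptReply (r : Fin m → Round (2 * n)) (j : ℕ) : ℝ :=
  reply (attack n (k := k) hd σ hm) O (r, twist s r V) o (s.map (encode hd V)) j

/-- The scores as a function of the rounds. -/
noncomputable def transcriptScore (r : Fin m → Round (2 * n)) (j : ℕ) (i : Fin (2 * n)) : ℝ :=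
  score σ r (transcriptReply (k := k) hd σ hm O o s V r) j i

/-- The accused users as a function of the rounds. -/
noncomputable def transcriptAccused (r : Fin m → Round (2 * n)) (j : ℕ) : Finset (Fin (2 * n)) :=
  accused σ r (transcriptReply (k := k) hd σ hm O o s V r) j

/-- The query that the attack asks in round `j` after the rounds `r`, if the threshold is `t`. -/
noncomputable def thresholdQuery (r : Fin m → Round (2 * n)) (j : Fin m) (t : ℕ) : Query d :=
  maskedQuery d j (transcriptAccused (k := k) hd σ hm O o s V r j) (maskedBits s V j t)

/-- The answer to the query of round `j` after the rounds `r`, if the threshold is `t`. -/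
noncomputable def thresholdReply (r : Fin m → Round (2 * n)) (j : Fin m) (t : ℕ) : ℝ :=
  O.answer j o (s.map (encode hd V)) (Fin.snoc (transcript (k := k) hd σ hm O o s V r j).1
    (thresholdQuery (k := k) hd σ hm O o s V r j t))

theorem mem_transcriptAccused (r : Fin m → Round (2 * n)) (j : ℕ) (i : Fin (2 * n)) :
    i ∈ transcriptAccused (k := k) hd σ hm O o s V r j ↔
      σ < transcriptScore (k := k) hd σ hm O o s V r j i := by
  simp [transcriptAccused, transcriptScore, accused]

/-- Outside `s` the key is bit xor `V`, so the published masked bit is `V` itself and no trace of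
the round's bit remains. This is the secrecy of the one-time pad in deterministic form. -/
theorem transcript_fst_succ (r : Fin m → Round (2 * n)) (j : Fin m) :
    (transcript (k := k) hd σ hm O o s V r (j + 1)).1 =
      Fin.snoc (transcript (k := k) hd σ hm O o s V r j).1
        (thresholdQuery (k := k) hd σ hm O o s V r j (r j).threshold) := by
  have hT : accused σ r (extendZero (transcript (k := k) hd σ hm O o s V r j).2) j =
      transcriptAccused (k := k) hd σ hm O o s V r j :=
    accused_congr σ (fun _ _ => rfl) fun l hl => extendZero_play _ _ _ _ _ hl
  suffices hq : attackQuery d σ j (r, twist s r V)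
      (transcript (k := k) hd σ hm O o s V r j).2 =
      thresholdQuery (k := k) hd σ hm O o s V r j (r j).threshold by
    rw [← hq]
    rfl
  rw [thresholdQuery, ← hT]
  simp only [attackQuery, j.is_lt, dif_pos, Fin.eta]
  refine maskedQuery_congr _ fun i _ => ?_
  simp only [twist, maskedBits]
  split_ifs
  · rfl
  · simp

theorem transcriptReply_eq (r : Fin m → Round (2 * n)) (j : Fin m) :
    transcriptReply (k := k) hd σ hm O o s V r j =
      thresholdReply (k := k) hd σ hm O o s V r j (r j).threshold := by
  rw [thresholdReply, ← transcript_fst_succ]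
  exact reply_eq _ _ _ _ _ _

/-- Causality: with oracle coins, sample and `V` fixed, the past of round `j` is determined by the
earlier rounds. This justifies resampling one round at a time. -/
theorem transcript_congr {r r' : Fin m → Round (2 * n)} {j : ℕ} (hj : j ≤ m)
    (h : ∀ l : Fin m, l.val < j → r l = r' l) :
    transcript (k := k) hd σ hm O o s V r j = transcript (k := k) hd σ hm O o s V r' j ∧
      ∀ l < j, transcriptReply (k := k) hd σ hm O o s V r l =
        transcriptReply (k := k) hd σ hm O o s V r' l := by
  induction j with
  | zero => exact ⟨rfl, fun l hl => absurd hl (Nat.not_lt_zero l)⟩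
  | succ j ih =>
    obtain ⟨ih1, ih2⟩ := ih (by omega) fun l hl => h l (by omega)
    have hq : ∀ t, thresholdQuery (k := k) hd σ hm O o s V r ⟨j, hj⟩ t =
        thresholdQuery (k := k) hd σ hm O o s V r' ⟨j, hj⟩ t := fun t => by
      rw [thresholdQuery, thresholdQuery, transcriptAccused, transcriptAccused,
        accused_congr σ (fun l hl => h l (Nat.lt_succ_of_lt hl)) ih2]
    have h1 : (transcript (k := k) hd σ hm O o s V r (j + 1)).1 =
        (transcript (k := k) hd σ hm O o s V r' (j + 1)).1 := by
      rw [transcript_fst_succ (j := ⟨j, hj⟩), transcript_fst_succ (j := ⟨j, hj⟩), hq,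
        h ⟨j, hj⟩ (Nat.lt_succ_self j), ih1]
    have h2 : ∀ l < j + 1, transcriptReply (k := k) hd σ hm O o s V r l =
        transcriptReply (k := k) hd σ hm O o s V r' l := fun l hl => by
      rcases Nat.lt_succ_iff_lt_or_eq.1 hl with hl | rfl
      · exact ih2 l hl
      · exact (reply_eq _ _ _ _ _ _).trans ((congrArg _ h1).trans (reply_eq _ _ _ _ _ _).symm)
    refine ⟨Prod.ext h1 (funext fun l => ?_), h2⟩
    exact (play_snd_apply _ _ _ _ _ l).trans ((h2 l l.is_lt).trans
      (play_snd_apply _ _ _ _ _ l).symm)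

theorem transcriptScore_update (r : Fin m → Round (2 * n)) (j : Fin m) (w : Round (2 * n))
    (i : Fin (2 * n)) :
    transcriptScore (k := k) hd σ hm O o s V (Function.update r j w) (j + 1) i =
      transcriptScore (k := k) hd σ hm O o s V r j i +
        if w.1 = i ∧ transcriptScore (k := k) hd σ hm O o s V r j i ≤ σ then
          if w.2 then thresholdReply (k := k) hd σ hm O o s V r j w.threshold
          else -thresholdReply (k := k) hd σ hm O o s V r j w.threshold
        else 0 := by
  have hr : ∀ l : Fin m, l.val < j → Function.update r j w l = r l := fun l hl =>
    Function.update_of_ne (fun h => by simp [h] at hl) _ _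
  obtain ⟨h1, h2⟩ := transcript_congr (k := k) hd σ hm O o s V j.is_lt.le hr
  have h3 : ∀ i, score σ (Function.update r j w)
      (transcriptReply (k := k) hd σ hm O o s V (Function.update r j w)) j i =
      transcriptScore (k := k) hd σ hm O o s V r j i := fun i =>
    congrFun (score_congr σ hr h2) i
  have h4 : transcriptReply (k := k) hd σ hm O o s V (Function.update r j w) j =
      thresholdReply (k := k) hd σ hm O o s V r j w.threshold := by
    rw [transcriptReply_eq, Function.update_self, thresholdReply, thresholdReply, h1,
      thresholdQuery, thresholdQuery, transcriptAccused, transcriptAccused,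
      accused_congr σ hr h2]
  rw [transcriptScore, score, h3]
  simp only [j.is_lt, dif_pos, Fin.eta, Function.update_self, h4]

theorem thresholdReply_mem (r : Fin m → Round (2 * n)) (j : Fin m) (t : ℕ) :
    thresholdReply (k := k) hd σ hm O o s V r j t ∈ Set.Icc (0 : ℝ) 1 :=
  O.answer_mem _ _ _ _

/-- The reply does not depend on the bits of the users outside `s` and of the accused users. -/
theorem thresholdReply_eq_of_not_mem (r : Fin m → Round (2 * n)) (j : Fin m) {v w : Round (2 * n)}
    (hvw : v.1 = w.1)
    (hv : v.1 ∉ s ∨ v.1 ∈ transcriptAccused (k := k) hd σ hm O o s V r j) :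
    thresholdReply (k := k) hd σ hm O o s V r j v.threshold =
      thresholdReply (k := k) hd σ hm O o s V r j w.threshold := by
  rw [thresholdReply, thresholdReply, thresholdQuery, thresholdQuery]
  congr 2
  -- The oracle sees the same query in both cases: accused users are removed from it, and users
  -- outside `s` contribute only `V`.
  refine maskedQuery_congr _ fun i hi => ?_
  simp only [maskedBits]
  split_ifs with his
  · rw [thresholdBits_of_ne v w hvw]
    rintro rfl
    tauto
  · rfl

theorem mean_thresholdQuery (r : Fin m → Round (2 * n)) (j : Fin m) (t : ℕ) :
    (thresholdQuery (k := k) hd σ hm O o s V r j t).mean (s.map (encode hd V)) =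
      (((s \ transcriptAccused (k := k) hd σ hm O o s V r j).filter
        fun i => i.val < t).card : ℝ) / s.card := by
  rw [Query.mean, Finset.card_map, Finset.sum_map, Finset.sum_boole]
  congr 3
  ext i
  simp only [Finset.mem_filter, Finset.mem_sdiff, thresholdQuery, maskedQuery_encode, maskedBits,
    and_assoc]
  refine and_congr_right fun hi => ?_
  simp [hi, thresholdBits]

/-- User `i` is selected with probability `1 / (2n)`. When selected and not frozen, the increment is
`±a` with a fair sign and `a` independent of the sign, so the factor is `cosh (c a)`; otherwise it
is `1`. -/
theorem expect_exp_score_le (hn : 0 < n) {c : ℝ} (hc : |c| ≤ 1) {i : Fin (2 * n)} (hi : i ∉ s)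
    (r : Fin m → Round (2 * n)) (j : Fin m) :
    𝔼 w, Real.exp (c * transcriptScore (k := k) hd σ hm O o s V (Function.update r j w) (j + 1) i) ≤
      (1 + c ^ 2 / (2 * n)) *
        Real.exp (c * transcriptScore (k := k) hd σ hm O o s V r j i) := by
  have : NeZero (2 * n) := ⟨by omega⟩
  simp only [transcriptScore_update]
  set S := transcriptScore (k := k) hd σ hm O o s V r j i
  have hX := Real.exp_pos (c * S)
  rw [← Finset.univ_product_univ, Finset.expect_product]
  calc _ ≤ 𝔼 p : Fin (2 * n), (1 + if p = i then c ^ 2 else 0) * Real.exp (c * S) := by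
        refine Finset.expect_le_expect fun p _ => ?_
        by_cases hp : p = i ∧ S ≤ σ
        · obtain ⟨rfl, hSσ⟩ := hp
          have e : thresholdReply (k := k) hd σ hm O o s V r j (Round.threshold (p, true)) =
              thresholdReply (k := k) hd σ hm O o s V r j (Round.threshold (p, false)) :=
            thresholdReply_eq_of_not_mem (k := k) hd σ hm O o s V r j
              (v := (p, true)) (w := (p, false)) rfl (Or.inl hi)
          obtain ⟨ha0, ha1⟩ := thresholdReply_mem (k := k) hd σ hm O o s V r j
            (Round.threshold (p, false))
          simp only [Fintype.expect_eq_sum_div_card, Fintype.sum_bool, Fintype.card_bool, hSσ,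
            and_self, if_true, Bool.false_eq_true, if_false, e, mul_add, Real.exp_add]
          set a := thresholdReply (k := k) hd σ hm O o s V r j (Round.threshold (p, false))
          have h1 := Real.cosh_le_exp_half_sq (c * a)
          rw [Real.cosh_eq] at h1
          have hc2 : c ^ 2 ≤ 1 := (sq_le_one_iff_abs_le_one c).2 hc
          have hca : (c * a) ^ 2 ≤ c ^ 2 := by
            rw [mul_pow]
            exact mul_le_of_le_one_right (sq_nonneg c) (pow_le_one₀ ha0 ha1)
          -- Linearises the exponential: `cosh (c a) ≤ exp ((c a)^2 / 2) ≤ 1 + (c a)^2 ≤ 1 + c^2`.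
          have h2 := Real.abs_exp_sub_one_le (x := (c * a) ^ 2 / 2) (by
            rw [abs_of_nonneg (by positivity)]; linarith)
          rw [abs_of_nonneg (by positivity : (0:ℝ) ≤ (c * a) ^ 2 / 2)] at h2
          have h3 := (abs_le.1 h2).2
          rw [mul_neg]
          push_cast
          have h4 : (Real.exp (c * a) + Real.exp (-(c * a))) / 2 ≤ 1 + c ^ 2 := by linarith
          calc _ = (Real.exp (c * a) + Real.exp (-(c * a))) / 2 * Real.exp (c * S) := by ring
            _ ≤ _ := mul_le_mul_of_nonneg_right h4 hX.le
        · simp only [hp, if_false, add_zero]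
          rw [Fintype.expect_const]
          refine le_mul_of_one_le_left hX.le ?_
          split_ifs <;> nlinarith [sq_nonneg c]
    _ = _ := by
      rw [← Finset.expect_mul, Finset.expect_add_distrib, Fintype.expect_const,
        Fintype.expect_eq_sum_div_card]
      simp

end Analysis

/-! ### False accusations and missed sample users -/

section Analysis

variable {n d k m : ℕ} (hd : 2 * n + m ≤ d) (σ : ℝ) (hm : Nonempty (Fin m → Round (2 * n)))
  (O : Oracle.{u} d) (o : O.Coins) (s : Finset (Fin (2 * n))) (V : Fin (2 * n) → Fin m → Bool)

theorem transcriptReply_mem (r : Fin m → Round (2 * n)) (j : ℕ) :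
    transcriptReply (k := k) hd σ hm O o s V r j ∈ Set.Icc (0 : ℝ) 1 := by
  have h := reply_eq (attack (k := k) n hd σ hm) O (r, twist s r V) o (s.map (encode hd V)) j
  rw [transcriptReply, h]
  exact O.answer_mem _ _ _ _

theorem transcriptScore_le (hσ : 0 ≤ σ) (r : Fin m → Round (2 * n)) (j : ℕ) (i : Fin (2 * n)) :
    transcriptScore (k := k) hd σ hm O o s V r j i ≤ σ + 1 := by
  induction j with
  | zero => simp only [transcriptScore, score]; linarith
  | succ j ih =>
    obtain ⟨h0, h1⟩ := transcriptReply_mem (k := k) hd σ hm O o s V r j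
    simp only [transcriptScore, score] at ih ⊢
    split_ifs with _ h
    · linarith [h.2]
    · linarith [h.2]
    · linarith
    · linarith

/-- It is unlikely that a user outside the sample is accused. -/
theorem expect_exists_accused_le (hn : 0 < n) {c : ℝ} (hc0 : 0 ≤ c) (hc : c ≤ 1) :
    (𝔼 r, if ∃ i ∉ s, i ∈ transcriptAccused (k := k) hd σ hm O o s V r m then (1 : ℝ) else 0) ≤
      2 * n * (Real.exp (-(c * σ)) * (1 + c ^ 2 / (2 * n)) ^ m) := by
  have : NeZero (2 * n) := ⟨by omega⟩
  calc _ ≤ 𝔼 r, ∑ i ∈ sᶜ, Real.exp (-(c * σ)) *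
          Real.exp (c * transcriptScore (k := k) hd σ hm O o s V r m i) := by
        refine Finset.expect_le_expect fun r _ => ?_
        split_ifs with h
        · obtain ⟨i, hi, hi'⟩ := h
          rw [mem_transcriptAccused] at hi'
          refine le_trans ?_ (Finset.single_le_sum (fun i _ => by positivity)
            (Finset.mem_compl.2 hi))
          rw [← Real.exp_add]
          refine Real.one_le_exp ?_
          nlinarith
        · positivity
    _ = ∑ i ∈ sᶜ, Real.exp (-(c * σ)) *
          𝔼 r, Real.exp (c * transcriptScore (k := k) hd σ hm O o s V r m i) := by
        rw [Finset.expect_sum_comm]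
        simp only [Finset.mul_expect]
    _ ≤ ∑ i ∈ sᶜ, Real.exp (-(c * σ)) * (1 + c ^ 2 / (2 * n)) ^ m := by
        refine Finset.sum_le_sum fun i hi => mul_le_mul_of_nonneg_left ?_ (Real.exp_pos _).le
        have := expect_le_pow_mul
          (fun j r => Real.exp (c * transcriptScore (k := k) hd σ hm O o s V r j i))
          (K := 1 + c ^ 2 / (2 * n)) (by positivity)
          (fun j r => expect_exp_score_le (k := k) hd σ hm O o s V hn
            (by rwa [abs_of_nonneg hc0]) (Finset.mem_compl.1 hi) r j) m le_rfl
        simpa [transcriptScore, score] using this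
    _ ≤ _ := by
        rw [Finset.sum_const, nsmul_eq_mul]
        refine mul_le_mul_of_nonneg_right ?_ (by positivity)
        have : (sᶜ.card : ℝ) ≤ (Finset.univ : Finset (Fin (2 * n))).card := by
          exact_mod_cast Finset.card_le_univ _
        simpa using this

/-- The total score of the sampled users increases in expectation. -/
theorem expect_sum_score (r : Fin m → Round (2 * n)) (j : Fin m) :
    𝔼 w, ∑ i ∈ s, transcriptScore (k := k) hd σ hm O o s V (Function.update r j w) (j + 1) i =
      ∑ i ∈ s, transcriptScore (k := k) hd σ hm O o s V r j i +
        (thresholdReply (k := k) hd σ hm O o s V r j (2 * n) -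
          thresholdReply (k := k) hd σ hm O o s V r j 0) / (4 * n) := by
  have hN : Nonempty (Round (2 * n)) := ⟨r j⟩
  simp only [transcriptScore_update, Finset.sum_add_distrib, Finset.expect_add_distrib]
  rw [Fintype.expect_const]
  congr 1
  set F := thresholdReply (k := k) hd σ hm O o s V r j
  have key : ∀ p : Fin (2 * n), ∑ b : Bool, ∑ i ∈ s,
      (if p = i ∧ transcriptScore (k := k) hd σ hm O o s V r j i ≤ σ then
        if b then F (Round.threshold (p, b)) else -F (Round.threshold (p, b)) else 0) =
      F (p + 1) - F p := by
    intro p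
    have h1 : Round.threshold (p, true) = p + 1 := rfl
    have h0 : Round.threshold (p, false) = p := rfl
    simp only [Fintype.sum_bool, h1, h0, if_true, Bool.false_eq_true, if_false]
    by_cases hp : p ∈ s ∧ transcriptScore (k := k) hd σ hm O o s V r j p ≤ σ
    · rw [Finset.sum_eq_single_of_mem p hp.1 (fun i _ hi => by simp [hi.symm]),
        Finset.sum_eq_single_of_mem p hp.1 (fun i _ hi => by simp [hi.symm])]
      simp [hp.2, sub_eq_add_neg]
    -- A user outside the sample or already frozen gains no score, but `F` does not jump at this
    -- user either, so the telescoping sum has no gaps.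
    · have e : F (p + 1) = F p :=
        thresholdReply_eq_of_not_mem (k := k) hd σ hm O o s V r j (v := (p, true))
          (w := (p, false)) rfl (by rw [mem_transcriptAccused, ← not_le]; tauto)
      rw [Finset.sum_eq_zero, Finset.sum_eq_zero, e]
      · simp
      · rintro i hi
        rw [if_neg]
        rintro ⟨rfl, h⟩
        exact hp ⟨hi, h⟩
      · rintro i hi
        rw [if_neg]
        rintro ⟨rfl, h⟩
        exact hp ⟨hi, h⟩
  rw [Fintype.expect_eq_sum_div_card, ← Finset.univ_product_univ, Finset.sum_product]
  simp only [key]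
  rw [Fin.sum_univ_eq_sum_range (fun p => F (p + 1) - F p), Finset.sum_range_sub]
  simp only [Fintype.card_prod, Fintype.card_fin, Fintype.card_bool]
  push_cast
  ring_nf

variable {α : ℝ}

/-- At threshold `2n` the query is `1` on every unaccused sampled user, and at threshold `0` it
vanishes on the sample; each answer is off by at most `α`. -/
theorem card_div_sub_le_thresholdReply_sub (hs : s.card = n)
    (hO : ∀ j o x (qs : Fin (j + 1) → Query d),
      |O.answer j o x qs - (qs (Fin.last j)).mean x| ≤ α)
    (r : Fin m → Round (2 * n)) (j : Fin m) :
    ((s \ transcriptAccused (k := k) hd σ hm O o s V r j).card : ℝ) / n - 2 * α ≤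
      thresholdReply (k := k) hd σ hm O o s V r j (2 * n) -
        thresholdReply (k := k) hd σ hm O o s V r j 0 := by
  have h : ∀ t, |thresholdReply (k := k) hd σ hm O o s V r j t -
      (thresholdQuery (k := k) hd σ hm O o s V r j t).mean (s.map (encode hd V))| ≤ α :=
    fun t => by
      have := hO j o (s.map (encode hd V)) (Fin.snoc (transcript (k := k) hd σ hm O o s V r j).1
        (thresholdQuery (k := k) hd σ hm O o s V r j t))
      rwa [Fin.snoc_last] at this
  have h1 := (abs_le.1 (h (2 * n))).1
  have h0 := (abs_le.1 (h 0)).2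
  rw [mean_thresholdQuery, hs] at h1 h0
  simp only [Fin.is_lt, Finset.filter_true, Nat.not_lt_zero, Finset.filter_false,
    Finset.card_empty, Nat.cast_zero, zero_div] at h1 h0
  linarith

/-- A score above `σ` is frozen, so accusations are never withdrawn. -/
theorem transcriptAccused_subset_update (r : Fin m → Round (2 * n)) (j : Fin m)
    (w : Round (2 * n)) : transcriptAccused (k := k) hd σ hm O o s V r j ⊆
      transcriptAccused (k := k) hd σ hm O o s V (Function.update r j w) (j + 1) := by
  intro i hi
  rw [mem_transcriptAccused] at hi ⊢
  rwa [transcriptScore_update, if_neg (fun h => not_le.2 hi h.2), add_zero]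

/-- It is unlikely that many sampled users are not accused. -/
theorem expect_card_sdiff_accused_le (hn : 0 < n) (hσ : 0 ≤ σ) (hs : s.card = n)
    (hO : ∀ j o x (qs : Fin (j + 1) → Query d),
      |O.answer j o x qs - (qs (Fin.last j)).mean x| ≤ 1 / 300) :
    (𝔼 r, if (n : ℝ) / 100 < (s \ transcriptAccused (k := k) hd σ hm O o s V r m).card
      then (1 : ℝ) else 0) * m ≤ 1200 * n ^ 2 * (σ + 1) := by
  have : NeZero (2 * n) := ⟨by omega⟩
  have hn' : (0 : ℝ) < n := by exact_mod_cast hn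
  set S := transcriptScore (k := k) hd σ hm O o s V with hS
  let U : ℕ → (Fin m → Round (2 * n)) → Prop := fun j r =>
    (n : ℝ) / 100 < (s \ transcriptAccused (k := k) hd σ hm O o s V r j).card
  -- Distance of the total score from its maximum `n (σ + 1)`, plus the guaranteed drift so far,
  -- killed once at most `n / 100` sampled users are unaccused. It is a nonnegative supermartingale.
  let X : ℕ → (Fin m → Round (2 * n)) → ℝ := fun j r => by
    classical exact if U j r then n * (σ + 1) - ∑ i ∈ s, S r j i + j / (1200 * n) else 0
  have hZ : ∀ j r, 0 ≤ n * (σ + 1) - ∑ i ∈ s, S r j i := fun j r => by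
    have := Finset.sum_le_card_nsmul s (S r j) (σ + 1) fun i _ =>
      transcriptScore_le (k := k) hd σ hm O o s V hσ r j i
    rw [hs, nsmul_eq_mul] at this
    linarith
  have hX : ∀ (j : Fin m) r, 𝔼 w, X (j + 1) (Function.update r j w) ≤ 1 * X j r := by
    intro j r
    rw [one_mul]
    by_cases hU : U j r
    · have h1 : ∀ w, X (j + 1) (Function.update r j w) ≤
          n * (σ + 1) + (j + 1) / (1200 * n) -
            ∑ i ∈ s, S (Function.update r j w) (j + 1) i := by
        intro w
        have h2 := hZ (j + 1) (Function.update r j w)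
        have h3 : (0 : ℝ) ≤ (j + 1) / (1200 * n) := by positivity
        simp only [X]
        split_ifs
        · push_cast
          linarith
        · linarith
      refine (Finset.expect_le_expect fun w _ => h1 w).trans ?_
      rw [Finset.expect_sub_distrib, Fintype.expect_const, expect_sum_score]
      have h4 := card_div_sub_le_thresholdReply_sub (k := k) hd σ hm O o s V hs hO r j
      have h5 : (1 : ℝ) / 100 <
          (s \ transcriptAccused (k := k) hd σ hm O o s V r j).card / n := by
        rw [lt_div_iff₀ hn']
        have : (n : ℝ) / 100 < _ := hU
        linarith
      simp only [X, hU, if_true]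
      set D := thresholdReply (k := k) hd σ hm O o s V r j (2 * n) -
        thresholdReply (k := k) hd σ hm O o s V r j 0
      -- `1/100 - 2 * (1/300) = 1/300`, and division by `4n` gives the drift `1 / (1200 n)`.
      have h6 : 1 / (1200 * (n : ℝ)) ≤ D / (4 * n) := by
        rw [div_le_div_iff₀ (by positivity) (by positivity)]
        nlinarith
      rw [add_div]
      linarith
    · have h1 : ∀ w, X (j + 1) (Function.update r j w) = 0 := by
        intro w
        refine if_neg fun h => hU (lt_of_lt_of_le h ?_)
        exact_mod_cast Finset.card_le_card (Finset.sdiff_subset_sdiff le_rfl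
          (transcriptAccused_subset_update (k := k) hd σ hm O o s V r j w))
      simp [h1, X, hU]
  have h := expect_le_pow_mul X zero_le_one hX m le_rfl
  rw [one_pow, one_mul] at h
  have h0 : 𝔼 r, X 0 r ≤ n * (σ + 1) := by
    refine Finset.expect_le Finset.univ_nonempty fun r _ => ?_
    simp only [X, hS, transcriptScore, score]
    split_ifs
    · simp
    · positivity
  have h1 : (𝔼 r, if U m r then (1 : ℝ) else 0) * (m / (1200 * n)) ≤ 𝔼 r, X m r := by
    rw [Finset.expect_mul]
    refine Finset.expect_le_expect fun r _ => ?_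
    simp only [X]
    split_ifs
    · linarith [hZ m r]
    · simp
  have h2 := (h1.trans h).trans h0
  rw [mul_div_assoc', div_le_iff₀ (by positivity)] at h2
  calc _ ≤ n * (σ + 1) * (1200 * n) := h2
    _ = _ := by ring

/-- Against an oracle that is always accurate, the attack rarely fails. -/
theorem expect_failure_le (hn : 0 < n) (hσ : 0 ≤ σ) (hs : s.card = n) (hm0 : 0 < m)
    (hO : ∀ j o x (qs : Fin (j + 1) → Query d),
      |O.answer j o x qs - (qs (Fin.last j)).mean x| ≤ 1 / 300)
    {c : ℝ} (hc0 : 0 ≤ c) (hc : c ≤ 1) :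
    (𝔼 r, if (n : ℝ) / 100 < (symmDiff s (transcriptAccused (k := k) hd σ hm O o s V r m)).card
      then (1 : ℝ) else 0) ≤
      2 * n * (Real.exp (-(c * σ)) * (1 + c ^ 2 / (2 * n)) ^ m) +
        1200 * n ^ 2 * (σ + 1) / m := by
  have hm' : (0 : ℝ) < m := by exact_mod_cast hm0
  have h1 := expect_exists_accused_le (k := k) hd σ hm O o s V hn hc0 hc
  have h2 := expect_card_sdiff_accused_le (k := k) hd σ hm O o s V hn hσ hs hO
  rw [← le_div_iff₀ hm'] at h2
  refine le_trans ?_ (add_le_add h1 h2)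
  rw [← Finset.expect_add_distrib]
  refine Finset.expect_le_expect fun r _ => ?_
  -- Without false accusations the symmetric difference is just the set of unaccused sampled users.
  by_cases h : ∃ i ∉ s, i ∈ transcriptAccused (k := k) hd σ hm O o s V r m
  · rw [if_pos h]
    split_ifs <;> norm_num
  · have : transcriptAccused (k := k) hd σ hm O o s V r m ⊆ s := fun i hi => by
      by_contra his
      exact h ⟨i, his, hi⟩
    rw [if_neg h, zero_add, symmDiff_def, Finset.sup_eq_union, Finset.sdiff_eq_empty_iff_subset.2 this,
      Finset.union_empty]

end Analysis

/-! ### Reduction to oracles that are always accurate -/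

section Correction

variable {n d k : ℕ}

theorem Query.mean_mem (q : Query d) (x : Finset (Point d)) : q.mean x ∈ Set.Icc (0 : ℝ) 1 := by
  rw [Query.mean, Finset.sum_boole]
  refine ⟨by positivity, div_le_one_of_le₀ ?_ (by positivity)⟩
  exact_mod_cast Finset.card_filter_le _ _

/-- The oracle `O` with coins `o`, corrected so that each answer is accurate. -/
noncomputable def Oracle.corrected (O : Oracle.{u} d) (o : O.Coins) (α : ℝ) : Oracle.{u} d where
  Coins := PUnit
  law := Measure.dirac PUnit.unit
  answer j _ x qs :=
    if |O.answer j o x qs - (qs (Fin.last j)).mean x| ≤ α then O.answer j o x qs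
    else (qs (Fin.last j)).mean x
  answer_mem j _ x qs := by
    split_ifs
    · exact O.answer_mem j o x qs
    · exact Query.mean_mem _ _
  measurable_answer _ _ _ := measurable_const

theorem Oracle.abs_corrected_sub_le (O : Oracle.{u} d) (o : O.Coins) {α : ℝ} (hα : 0 ≤ α) (j : ℕ)
    (o' : (O.corrected o α).Coins) (x : Finset (Point d)) (qs : Fin (j + 1) → Query d) :
    |(O.corrected o α).answer j o' x qs - (qs (Fin.last j)).mean x| ≤ α := by
  simp only [Oracle.corrected]
  split_ifs with h
  · exact h
  · simpa using hα

/-- The correction intervenes only on an inaccurate answer. Until one occurs, both interactions have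
the same history and hence the same next query and answer. -/
theorem play_corrected (A : Adversary n d k) (O : Oracle.{u} d) (a : A.Coins) (o : O.Coins)
    (x : Finset (Point d)) (α : ℝ) (j : ℕ)
    (h : ∀ l, |(play A O a o x j).2 l - ((play A O a o x j).1 l).mean x| ≤ α) :
    play A (O.corrected o α) a PUnit.unit x j = play A O a o x j := by
  induction j with
  | zero => rfl
  | succ j ih =>
    have ih := ih fun l => by simpa [play] using h l.castSucc
    have hl := h (Fin.last j)
    simp only [play, Fin.snoc_last] at hl
    simp only [play, ih]
    congr 2
    simp only [Oracle.corrected, Fin.snoc_last]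
    exact if_pos hl

end Correction

/-! ### Measurability, and conditioning on the subsample and the oracle coins -/

section Measurability

variable {n d k : ℕ} (A : Adversary n d k) (O : Oracle.{u} d)

instance : Finite (Subsample n) :=
  inferInstanceAs (Finite {s : Finset (Fin (2 * n)) // s.card = n})

instance : DiscreteMeasurableSpace (Subsample n) := ⟨fun _ => trivial⟩

instance : Nonempty (Subsample n) := by
  obtain ⟨s, -, hs⟩ := Finset.exists_subset_card_eq
    (s := (Finset.univ : Finset (Fin (2 * n)))) (n := n) (by simp; omega)
  exact ⟨⟨s, hs⟩⟩

theorem measurable_play (a : A.Coins) (x : Finset (Point d)) (j : ℕ) :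
    Measurable fun o => play A O a o x j := by
  induction j with
  | zero => exact measurable_const
  | succ j ih =>
    have hsnoc : ∀ (α : Type) [MeasurableSpace α],
        Measurable fun p : (Fin j → α) × α => (Fin.snoc p.1 p.2 : Fin (j + 1) → α) := by
      intro α _
      refine measurable_pi_lambda _ fun l => ?_
      induction l using Fin.lastCases with
      | last => simpa using measurable_snd
      | cast l =>
        simp only [Fin.snoc_castSucc]
        exact (measurable_pi_apply l).comp measurable_fst
    have hq : Measurable fun as : Fin j → ℝ => A.query j a as :=
      measurable_to_countable' fun q => measurable_prodMk_left (A.measurable_query j q)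
    have h1 : Measurable fun o => (play A O a o x (j + 1)).1 :=
      (hsnoc (Query d)).comp (ih.fst.prodMk (hq.comp ih.snd))
    have h2 : Measurable fun p : O.Coins × (Fin (j + 1) → Query d) => O.answer j p.1 x p.2 :=
      measurable_from_prod_countable_left fun qs => O.measurable_answer j x qs
    exact h1.prodMk ((hsnoc ℝ).comp (ih.snd.prodMk (h2.comp (measurable_id.prodMk h1))))

instance : IsProbabilityMeasure (gameLaw A O) := by
  unfold gameLaw
  infer_instance

/-- Fubini, integrating over the adversary's coins first. The attack works for every subsample and
every outcome of the oracle's coins, so a pointwise bound is enough. -/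
theorem gameLaw_real_le {E : Set (Run A O)} (hE : MeasurableSet E) {ε : ℝ}
    (h : ∀ s o, A.law.real {a | (a, s, o) ∈ E} ≤ ε) : (gameLaw A O).real E ≤ ε := by
  obtain ⟨o⟩ := O.law.nonempty_of_neZero
  obtain ⟨s⟩ : Nonempty (Subsample n) := inferInstance
  have hε : 0 ≤ ε := measureReal_nonneg.trans (h s o)
  refine ENNReal.toReal_le_of_le_ofReal hε ?_
  rw [gameLaw, Measure.prod_apply_symm hE]
  calc _ ≤ ∫⁻ _, ENNReal.ofReal ε ∂((ProbabilityTheory.uniformOn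
          (Set.univ : Set (Subsample n))).prod O.law) := by
        refine lintegral_mono fun p => ?_
        rw [ENNReal.le_ofReal_iff_toReal_le (measure_ne_top _ _) hε]
        exact h p.1 p.2
    _ = _ := by simp

variable [Countable A.Coins] [DiscreteMeasurableSpace A.Coins]

theorem measurableSet_run {E : Set (Run A O)}
    (h : ∀ a s, MeasurableSet {o : O.Coins | (a, s, o) ∈ E}) : MeasurableSet E := by
  have : Measurable fun w : Run A O => w ∈ E :=
    measurable_from_prod_countable_right fun a => measurable_from_prod_countable_right fun s =>
      measurableSet_setOfPred.1 (h a s)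
  exact measurableSet_setOfPred.2 this

theorem measurableSet_accurate (α : ℝ) : MeasurableSet
    {w : Run A O | ∀ j, |w.answers j - (w.queries j).mean w.sample| ≤ α} := by
  refine measurableSet_run A O fun a s => ?_
  have h := measurable_play A O a (s.val.map (A.points a)) k
  have : {o : O.Coins | ∀ j, |(play A O a o (s.val.map (A.points a)) k).2 j -
      ((play A O a o (s.val.map (A.points a)) k).1 j).mean (s.val.map (A.points a))| ≤ α} =
      ⋂ j, {o : O.Coins | |(play A O a o (s.val.map (A.points a)) k).2 j -
      ((play A O a o (s.val.map (A.points a)) k).1 j).mean (s.val.map (A.points a))| ≤ α} := by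
    ext
    simp
  change MeasurableSet {o : O.Coins | ∀ j, |(play A O a o (s.val.map (A.points a)) k).2 j -
      ((play A O a o (s.val.map (A.points a)) k).1 j).mean (s.val.map (A.points a))| ≤ α}
  rw [this]
  refine MeasurableSet.iInter fun j => measurableSet_le ?_ measurable_const
  have hm : Measurable fun q : Query d => q.mean (s.val.map (A.points a)) :=
    Measurable.of_discrete
  exact (((measurable_pi_apply j).comp h.snd).sub
    (hm.comp ((measurable_pi_apply j).comp h.fst))).abs

theorem measurableSet_output (P : Finset (Point d) → Finset (Point d) → Prop) : MeasurableSet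
    {w : Run A O | P w.sample w.output} := by
  refine measurableSet_run A O fun a s => ?_
  have h := measurable_play A O a (s.val.map (A.points a)) k
  have : {o : O.Coins | ((a, s, o) : Run A O) ∈ {w : Run A O | P w.sample w.output}} =
      ⋃ t ∈ {t : Finset (Fin (2 * n)) | P (s.val.map (A.points a)) (t.map (A.points a))},
        {o | A.guess a (play A O a o (s.val.map (A.points a)) k).2 = t} := by
    ext o
    simp only [Set.mem_ofPred_eq, Set.mem_iUnion, exists_prop, exists_eq_right']
    rfl
  rw [this]
  refine MeasurableSet.biUnion (Set.to_countable _) fun t _ => ?_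
  have hg : MeasurableSet {as | A.guess a as = t} := measurable_prodMk_left (A.measurable_guess t)
  exact h.snd hg

/-- Against a sample-accurate oracle, it suffices to bound the failures in accurate runs. -/
theorem gameLaw_real_failure_le {α β ε : ℝ} (hO : O.SampleAccurate n k α β)
    (P : Finset (Point d) → Finset (Point d) → Prop)
    (h : ∀ (s : Subsample n) o, A.law.real {a |
      (∀ j, |(play A O a o (s.val.map (A.points a)) k).2 j -
        ((play A O a o (s.val.map (A.points a)) k).1 j).mean (s.val.map (A.points a))| ≤ α) ∧
      P (s.val.map (A.points a)) ((A.guess a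
        (play A O a o (s.val.map (A.points a)) k).2).map (A.points a))} ≤ ε) :
    (gameLaw A O).real {w | P w.sample w.output} ≤ β + ε := by
  have hacc := measurableSet_accurate A O α
  set G := {w : Run A O | ∀ j, |w.answers j - (w.queries j).mean w.sample| ≤ α}
  have h1 : (gameLaw A O).real Gᶜ ≤ β := by
    rw [measureReal_compl hacc, probReal_univ]
    linarith [hO A]
  have h2 : (gameLaw A O).real (G ∩ {w | P w.sample w.output}) ≤ ε :=
    gameLaw_real_le A O (hacc.inter (measurableSet_output A O P)) h
  calc _ ≤ (gameLaw A O).real (Gᶜ ∪ (G ∩ {w | P w.sample w.output})) := by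
        refine measureReal_mono fun w hw => ?_
        by_cases hwG : w ∈ G
        · exact Or.inr ⟨hwG, hw⟩
        · exact Or.inl hwG
    _ ≤ _ := (measureReal_union_le _ _).trans (add_le_add h1 h2)

end Measurability

theorem uniformOn_univ_real {Ω : Type*} [Fintype Ω] [MeasurableSpace Ω]
    [MeasurableSingletonClass Ω] (p : Ω → Prop) [DecidablePred p] :
    (ProbabilityTheory.uniformOn (Set.univ : Set Ω)).real {a | p a} =
      𝔼 a, if p a then (1 : ℝ) else 0 := by
  rw [Measure.real, ProbabilityTheory.uniformOn_univ, Fintype.expect_eq_sum_div_card,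
    Finset.sum_boole, ENNReal.toReal_div, Measure.count_apply_finite _ (Set.toFinite _)]
  simp

theorem card_symmDiff_map {α β : Type*} [DecidableEq α] [DecidableEq β] (f : α ↪ β)
    (s t : Finset α) : (symmDiff (s.map f) (t.map f)).card = (symmDiff s t).card := by
  rw [← Finset.card_map f]
  congr 1
  ext b
  simp only [Finset.mem_symmDiff, Finset.mem_map]
  constructor
  · rintro (⟨⟨i, hi, rfl⟩, h⟩ | ⟨⟨i, hi, rfl⟩, h⟩)
    · exact ⟨i, Or.inl ⟨hi, fun h' => h ⟨i, h', rfl⟩⟩, rfl⟩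
    · exact ⟨i, Or.inr ⟨hi, fun h' => h ⟨i, h', rfl⟩⟩, rfl⟩
  · rintro ⟨i, ⟨hi, h⟩ | ⟨hi, h⟩, rfl⟩
    · exact Or.inl ⟨⟨i, hi, rfl⟩, by simpa using h⟩
    · exact Or.inr ⟨⟨i, hi, rfl⟩, by simpa using h⟩

/-! ### Failure probability of the attack -/

/-- Masking the keys of the users outside `s` is a bijection on the coins of the attack. -/
def twistEquiv {N m : ℕ} (s : Finset (Fin N)) :
    (Fin m → Round N) × (Fin N → Fin m → Bool) ≃ (Fin m → Round N) × (Fin N → Fin m → Bool) where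
  toFun c := (c.1, twist s c.1 c.2)
  invFun c := (c.1, twist s c.1 c.2)
  left_inv c := by simp only [twist_twist]
  right_inv c := by simp only [twist_twist]

section Attack

variable {n d k m : ℕ} (hd : 2 * n + m ≤ d) (σ : ℝ) (hm : Nonempty (Fin m → Round (2 * n)))

instance : Countable (attack (k := k) n hd σ hm).Coins :=
  inferInstanceAs (Countable ((Fin m → Round (2 * n)) × (Fin (2 * n) → Fin m → Bool)))

instance : DiscreteMeasurableSpace (attack (k := k) n hd σ hm).Coins :=
  inferInstanceAs (DiscreteMeasurableSpace
    ((Fin m → Round (2 * n)) × (Fin (2 * n) → Fin m → Bool)))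

/-- The probability of failure in an accurate run of the attack. -/
theorem gameLaw_attack_real_le (hk : m ≤ k) (hn : 0 < n) (hσ : 0 ≤ σ) (hm0 : 0 < m)
    {c β : ℝ} (hc0 : 0 ≤ c) (hc : c ≤ 1) {O : Oracle.{u} d}
    (hO : O.SampleAccurate n k (1 / 300) β) :
    (gameLaw (attack (k := k) n hd σ hm) O).real
      {w | (n : ℝ) / 100 < (symmDiff w.sample w.output).card} ≤
      β + (2 * n * (Real.exp (-(c * σ)) * (1 + c ^ 2 / (2 * n)) ^ m) +
        1200 * n ^ 2 * (σ + 1) / m) := by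
  refine gameLaw_real_failure_le _ O hO
    (fun x x' => (n : ℝ) / 100 < (symmDiff x x').card) fun s o => ?_
  set O' := O.corrected o (1 / 300)
  have hacc := O.abs_corrected_sub_le o (α := 1 / 300) (by norm_num)
  calc _ ≤ (ProbabilityTheory.uniformOn (Set.univ : Set
        ((Fin m → Round (2 * n)) × (Fin (2 * n) → Fin m → Bool)))).real
        {a | (n : ℝ) / 100 < (symmDiff s.val (accused σ a.1
          (reply (attack (k := k) n hd σ hm) O' a PUnit.unit (s.val.map (encode hd a.2)))
          m)).card} := by
        refine measureReal_mono fun a ha => ?_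
        obtain ⟨h1, h2⟩ := ha
        have h3 := play_corrected _ _ _ _ _ _ _ h1
        rw [← h3, card_symmDiff_map] at h2
        refine lt_of_lt_of_eq h2 ?_
        congr 3
        exact accused_congr σ (fun _ _ => rfl) fun l hl =>
          extendZero_play _ _ _ _ _ (lt_of_lt_of_le hl hk)
    _ = 𝔼 a : (Fin m → Round (2 * n)) × (Fin (2 * n) → Fin m → Bool),
        if (n : ℝ) / 100 < (symmDiff s.val (accused σ a.1
          (reply (attack (k := k) n hd σ hm) O' a PUnit.unit (s.val.map (encode hd a.2)))
          m)).card then (1 : ℝ) else 0 := uniformOn_univ_real _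
    _ = 𝔼 a : (Fin m → Round (2 * n)) × (Fin (2 * n) → Fin m → Bool),
        if (n : ℝ) / 100 < (symmDiff s.val
          (transcriptAccused (k := k) hd σ hm O' PUnit.unit s.val a.2 a.1 m)).card
          then (1 : ℝ) else 0 := by
        -- Change of variables from keys to `V`. The sample is unaffected, since keys inside `s` do
        -- not change; afterwards `V` can be fixed and only the rounds stay random.
        refine (Fintype.expect_equiv (twistEquiv s.val) _ _ fun a => ?_).symm
        change _ = if (n : ℝ) / 100 < (symmDiff s.val (accused σ a.1
          (reply (attack (k := k) n hd σ hm) O' (a.1, twist s.val a.1 a.2) PUnit.unit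
            (s.val.map (encode hd (twist s.val a.1 a.2)))) m)).card then (1 : ℝ) else 0
        rw [map_encode_twist]
        rfl
    _ = 𝔼 V : Fin (2 * n) → Fin m → Bool, 𝔼 r : Fin m → Round (2 * n),
        if (n : ℝ) / 100 < (symmDiff s.val
          (transcriptAccused (k := k) hd σ hm O' PUnit.unit s.val V r m)).card
          then (1 : ℝ) else 0 := by
        rw [← Finset.univ_product_univ, Finset.expect_product, Finset.expect_comm]
    _ ≤ _ := Finset.expect_le Finset.univ_nonempty fun V _ =>
        expect_failure_le (k := k) hd σ hm O' PUnit.unit s.val V hn hσ s.2 hm0 hacc hc0 hc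

end Attack

/-! ### Choice of parameters and asymptotics -/

/-- The logarithmic factor in the parameters. -/
def logFactor (n : ℕ) : ℕ := Nat.log 2 n + 1

/-- The number of queries of the attack. -/
def numQueries (n : ℕ) : ℕ := n ^ 3 * logFactor n ^ 4

theorem tendsto_logFactor : Tendsto (fun n => (logFactor n : ℝ)) atTop atTop := by
  refine tendsto_natCast_atTop_atTop.comp ?_
  refine tendsto_atTop_atTop.2 fun b => ⟨2 ^ b, fun n hn => ?_⟩
  have := Nat.log_mono_right (b := 2) hn
  rw [Nat.log_pow (by norm_num)] at this
  unfold logFactor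
  omega

theorem isPowAddLittleO_of_le {f : ℕ → ℕ} (h1 : ∀ n, n ^ 3 ≤ f n)
    (h2 : ∀ n, f n ≤ 3 * n ^ 3 * logFactor n ^ 4) : IsPowAddLittleO f 3 := by
  have hlog : Tendsto (fun n : ℕ => Real.log n) atTop atTop :=
    Real.tendsto_log_atTop.comp tendsto_natCast_atTop_atTop
  refine ⟨fun n => Real.log (f n) / Real.log n - 3, ?_, ?_⟩
  · have hup : Tendsto (fun n : ℕ => (Real.log 3 + 4 * Real.log (2 + 2 * Real.log n)) /
        Real.log n) atTop (𝓝 0) := by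
      have h : (fun x : ℝ => Real.log 3 + 4 * Real.log (2 + 2 * x)) =o[atTop] fun x => x := by
        refine (Asymptotics.isLittleO_const_id_atTop _).add (Asymptotics.IsLittleO.const_mul_left ?_ _)
        have h2 : Tendsto (fun x : ℝ => 2 + 2 * x) atTop atTop :=
          tendsto_atTop_add_const_left _ _ (tendsto_id.const_mul_atTop two_pos)
        refine (Real.isLittleO_log_id_atTop.comp_tendsto h2).trans_isBigO ?_
        exact ((Asymptotics.isLittleO_const_id_atTop (2 : ℝ)).isBigO).add
          ((Asymptotics.isBigO_refl _ _).const_mul_left 2)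
      exact (h.comp_tendsto hlog).tendsto_div_nhds_zero
    refine squeeze_zero' ?_ ?_ hup
    · filter_upwards [eventually_ge_atTop 2] with n hn
      have hn' : (1 : ℝ) < n := by exact_mod_cast hn
      have := Real.log_pos hn'
      rw [sub_nonneg, le_div_iff₀ this]
      calc 3 * Real.log n = Real.log ((n : ℝ) ^ 3) := by rw [Real.log_pow]; norm_num
        _ ≤ _ := Real.log_le_log (by positivity) (by exact_mod_cast h1 n)
    · filter_upwards [eventually_ge_atTop 2] with n hn
      have hn' : (1 : ℝ) < n := by exact_mod_cast hn
      have hp := Real.log_pos hn'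
      have hf : (0 : ℝ) < f n := by
        have : 0 < f n := lt_of_lt_of_le (by positivity) (h1 n)
        exact_mod_cast this
      have hL : (0 : ℝ) < logFactor n := by unfold logFactor; positivity
      -- Since `log 2 > 1/2`, passing from base `2` to the natural logarithm costs at most a factor
      -- `2`.
      have hL2 : (logFactor n : ℝ) ≤ 2 + 2 * Real.log n := by
        have h3 : (2 : ℝ) ^ Nat.log 2 n ≤ n := by exact_mod_cast Nat.pow_log_le_self 2 (by omega)
        have h4 := Real.log_le_log (by positivity) h3
        rw [Real.log_pow] at h4
        have h5 := Real.log_two_gt_d9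
        have h6 : (0 : ℝ) ≤ Nat.log 2 n := by positivity
        simp only [logFactor]
        push_cast
        nlinarith
      rw [sub_le_iff_le_add, div_add' _ _ _ hp.ne', div_le_div_iff_of_pos_right hp]
      calc Real.log (f n) ≤ Real.log (3 * (n : ℝ) ^ 3 * (logFactor n : ℝ) ^ 4) :=
            Real.log_le_log hf (by exact_mod_cast h2 n)
        _ = Real.log 3 + 3 * Real.log n + 4 * Real.log (logFactor n) := by
            rw [Real.log_mul (by positivity) (by positivity),
              Real.log_mul (by positivity) (by positivity), Real.log_pow, Real.log_pow]
            norm_num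
        _ ≤ Real.log 3 + 3 * Real.log n + 4 * Real.log (2 + 2 * Real.log n) := by
            gcongr
        _ = _ := by ring
  · filter_upwards [eventually_ge_atTop 2] with n hn
    have hn' : (1 : ℝ) < n := by exact_mod_cast hn
    have hp := Real.log_pos hn'
    have hf : (0 : ℝ) < f n := by
      have : 0 < f n := lt_of_lt_of_le (by positivity) (h1 n)
      exact_mod_cast this
    rw [add_sub_cancel, Real.rpow_def_of_pos (by linarith), mul_div_cancel₀ _ hp.ne',
      Real.exp_log hf]

theorem one_le_logFactor (n : ℕ) : 1 ≤ logFactor n := Nat.le_add_left _ _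

theorem isPowAddLittleO_numQueries : IsPowAddLittleO numQueries 3 := by
  refine isPowAddLittleO_of_le (fun n => ?_) fun n => ?_
  · exact Nat.le_mul_of_pos_right _ (pow_pos (one_le_logFactor n) 4)
  · rw [numQueries, mul_assoc]
    omega

theorem isPowAddLittleO_dimension : IsPowAddLittleO (fun n => 2 * n + numQueries n) 3 := by
  have h (n) : n ^ 3 ≤ numQueries n :=
    Nat.le_mul_of_pos_right _ (pow_pos (one_le_logFactor n) 4)
  refine isPowAddLittleO_of_le (fun n => ?_) fun n => ?_
  · exact (h n).trans (Nat.le_add_left _ _)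
  · have h1 : n ≤ n ^ 3 := Nat.le_self_pow (by norm_num) n
    have h2 : 3 * n ^ 3 * logFactor n ^ 4 = 3 * numQueries n := by rw [numQueries]; ring
    have := h n
    simp only [h2]
    omega

theorem nonempty_rounds (n : ℕ) : Nonempty (Fin (numQueries n) → Round (2 * n)) := by
  rcases Nat.eq_zero_or_pos n with rfl | hn
  · exact ⟨fun j => absurd j.is_lt (by simp [numQueries])⟩
  · exact ⟨fun _ => (⟨0, by omega⟩, false)⟩

/-- The bound on the probability of failure for the chosen parameters. -/
theorem failure_bound_le {n : ℕ} (hn : 0 < n) (hL : 4 ≤ logFactor n) :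
    2 * n * (Real.exp (-(1 / (n * logFactor n) * (n * (logFactor n : ℝ) ^ 3))) *
      (1 + (1 / (n * (logFactor n : ℝ))) ^ 2 / (2 * n)) ^ numQueries n) +
      1200 * n ^ 2 * (n * (logFactor n : ℝ) ^ 3 + 1) / numQueries n ≤
    2 * Real.exp (-(logFactor n : ℝ)) + 2400 / logFactor n := by
  have hn' : (1 : ℝ) ≤ n := by exact_mod_cast hn
  have hn2 : (n : ℝ) ≤ Real.exp (logFactor n) := by
    have h1 : (n : ℝ) ≤ 2 ^ logFactor n := by
      exact_mod_cast (Nat.lt_pow_succ_log_self (by norm_num) n).le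
    refine h1.trans ?_
    rw [← Real.exp_one_pow]
    gcongr
    linarith [Real.exp_one_gt_d9]
  have hL' : (4 : ℝ) ≤ logFactor n := by exact_mod_cast hL
  have hm : (numQueries n : ℝ) = n ^ 3 * (logFactor n : ℝ) ^ 4 := by
    rw [numQueries]; push_cast; ring
  have hpow : (1 + (1 / (n * (logFactor n : ℝ))) ^ 2 / (2 * n)) ^ numQueries n ≤
      Real.exp ((logFactor n : ℝ) ^ 2 / 2) := by
    calc _ ≤ Real.exp ((1 / (n * (logFactor n : ℝ))) ^ 2 / (2 * n)) ^ numQueries n := by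
          gcongr
          rw [add_comm]
          exact Real.add_one_le_exp _
      _ = _ := by
          rw [← Real.exp_nat_mul, hm]
          congr 1
          field_simp
  rw [hm]
  set L : ℝ := (logFactor n : ℝ)
  refine add_le_add ?_ ?_
  · have e : 1 / (n * L) * (n * L ^ 3) = L ^ 2 := by field_simp
    rw [e]
    calc _ ≤ 2 * Real.exp L * (Real.exp (-L ^ 2) * Real.exp (L ^ 2 / 2)) := by
          gcongr
      _ = 2 * Real.exp (L + (-L ^ 2 + L ^ 2 / 2)) := by rw [Real.exp_add, Real.exp_add]; ring
      -- `L - L^2 / 2 ≤ -L` is exactly where `4 ≤ L` is needed.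
      _ ≤ _ := by
          gcongr
          nlinarith
  · rw [div_le_div_iff₀ (by positivity) (by positivity)]
    have h1 : 1 ≤ n * L ^ 3 := by
      have : 1 ≤ L ^ 3 := one_le_pow₀ (by linarith)
      nlinarith
    have h2 : 0 ≤ (n : ℝ) ^ 2 * L := by positivity
    nlinarith

theorem blatantlyNonPrivate {k d : ℕ → ℕ} (hk : ∀ n, numQueries n ≤ k n)
    (hd : ∀ n, 2 * n + numQueries n ≤ d n) : BlatantlyNonPrivate.{u} (1 / 300) k d := by
  -- With `σ = n L^3` and `c = 1 / (n L)`, one has `c σ = L^2`, while the exponential moment over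
  -- `n^3 L^4` rounds is at most `exp (L^2 / 2)`. The other error is about `1200 n^2 σ / m = 1200 /
  -- L`.
  refine ⟨fun n => attack n (hd n) (n * (logFactor n : ℝ) ^ 3) (nonempty_rounds n), ?_⟩
  rintro O ⟨β, hβ, hO⟩
  have hlim : Tendsto (fun n => β n +
      (2 * Real.exp (-(logFactor n : ℝ)) + 2400 / logFactor n)) atTop (𝓝 0) := by
    have h1 := (Real.tendsto_exp_neg_atTop_nhds_zero.comp tendsto_logFactor).const_mul 2
    have h2 := tendsto_logFactor.const_div_atTop 2400
    simpa using hβ.add (h1.add h2)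
  refine squeeze_zero' (Eventually.of_forall fun n => measureReal_nonneg) ?_ hlim
  filter_upwards [eventually_gt_atTop 0, tendsto_logFactor.eventually_ge_atTop 4] with n hn hL
  have hL' : 4 ≤ logFactor n := by exact_mod_cast hL
  have hn' : (1 : ℝ) ≤ n := by exact_mod_cast hn
  have hm0 : 0 < numQueries n := by
    have := one_le_logFactor n
    unfold numQueries
    positivity
  refine (gameLaw_attack_real_le (hd n) _ (nonempty_rounds n) (hk n) hn (by positivity) hm0
    (c := 1 / (n * logFactor n)) (by positivity) ?_ (hO n)).trans
    (add_le_add le_rfl (failure_bound_le hn hL'))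
  rw [div_le_one (by positivity)]
  nlinarith

end NonPrivacy

theorem mainTheorem5 :
    ∃ k₀ d₀ : ℕ → ℕ,
      NonPrivacy.IsPowAddLittleO k₀ 3 ∧ NonPrivacy.IsPowAddLittleO d₀ 3 ∧
      ∀ k d : ℕ → ℕ, (∀ n, k₀ n ≤ k n) → (∀ n, d₀ n ≤ d n) →
        NonPrivacy.BlatantlyNonPrivate.{u} (1 / 300) k d :=
  ⟨NonPrivacy.numQueries, fun n => 2 * n + NonPrivacy.numQueries n,
    NonPrivacy.isPowAddLittleO_numQueries, NonPrivacy.isPowAddLittleO_dimension,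
    fun _ _ hk hd => NonPrivacy.blatantlyNonPrivate hk hd⟩
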